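/- Let $r\ge 2$, let $m_1,\dots,m_r\ge 1$ be integers, put $m=\sum_{i=1}^r m_i$, and let $n\ge m$ be an integer. Let $K_{m_1,\dots,m_r}$ be the complete multipartite graph with parts of sizes $m_1,\dots,m_r$, and let $G=K_{m_1,\dots,m_r}\times K_n$ be its Kronecker product with the complete graph $K_n$: the vertex set is $V(K_{m_1,\dots,m_r})\times V(K_n)$, and $(x,y)$ is adjacent to $(x',y')$ if and only if $xx'$ and $yy'$ are both edges. A graph is equitably $k$-colorable if it has a proper coloring $f:V\to\{1,\dots,k\}$ whose color classes $f^{-1}(1),\dots,f^{-1}(k)$ (possibly empty) pairwise differ in size by at most $1$. The equitable chromatic threshold $\chi_=^*(G)$ is the least $t$ such that $G$ is equitably $k$-colorable for every $k\ge t$. If $$\sum_{i=1}^r\left\lfloor\frac{m_in}{m+1}\right\rfloor<\left\lfloor\frac{mn}{m+1}\right\rfloor,\qquad\text{or}\qquad \frac{m_in}{m+1}<\left\lceil\frac{m_in}{m+2}\right\rceil\ \text{ for some } i,$$ then $$\chi_=^*(G)=\left\lceil\frac{mn}{m+1}\right\rceil.$$ Otherwise there is a least integer $t\ge m+2$ such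 that either $\frac{m_in}{t}<\left\lceil\frac{m_in}{t+1}\right\rceil$ for some $i$, or $t$ divides neither $m_in$ nor $m_jn$ for some indices $i\ne j$; and, with $h$ denoting this least $t$, $$\chi_=^*(G)=\sum_{i=1}^r\left\lceil\frac{m_in}{h}\right\rceil.$$ -/

import Mathlib

namespace SimpleGraph

/-- The Kronecker (tensor, direct) product of two simple graphs: `(x, y)` and `(x', y')` are
adjacent iff `x` is adjacent to `x'` and `y` is adjacent to `y'`. -/
def kroneckerProd {V W : Type*} (G : SimpleGraph V) (H : SimpleGraph W) :
    SimpleGraph (V × W) where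
  Adj p q := G.Adj p.1 q.1 ∧ H.Adj p.2 q.2
  symm := ⟨fun _ _ h => ⟨h.1.symm, h.2.symm⟩⟩
  loopless := ⟨fun _ h => h.1.ne rfl⟩

/-- `G` is equitably `k`-colorable: it has a proper coloring with color set `Fin k` in which the
sizes of any two color classes (empty ones included) differ by at most `1`. -/
def EquitablyColorable {V : Type*} [Finite V] (G : SimpleGraph V) (k : ℕ) : Prop :=
  ∃ C : G.Coloring (Fin k), ∀ a b : Fin k,
    (C.colorClass a).ncard ≤ (C.colorClass b).ncard + 1

/-- `t` is the equitable chromatic threshold of `G`: the least `t` such that `G` is equitably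
`k`-colorable for all `k ≥ t`. -/
def IsEquitableChromaticThreshold {V : Type*} [Finite V] (G : SimpleGraph V) (t : ℕ) : Prop :=
  IsLeast {s : ℕ | ∀ k, s ≤ k → G.EquitablyColorable k} t

end SimpleGraph

/-- The Kronecker product of the complete multipartite graph with part sizes `m 0, …, m (r - 1)`
and the complete graph on `n` vertices. -/
def multipartiteTimesComplete {r : ℕ} (m : Fin r → ℕ) (n : ℕ) :
    SimpleGraph ((Σ i, Fin (m i)) × Fin n) :=
  (SimpleGraph.completeMultipartiteGraph fun i => Fin (m i)).kroneckerProd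
    (SimpleGraph.completeGraph (Fin n))

/-!
Write `M = ∑ i, m i` and `x i = m i * n`. An independent set of the product lies inside one part
or inside one column, which consists of the `M` vertices with a given second coordinate. This splits
the problem at `k = M n / (M + 1)`.

* If `M n ≤ (M + 1) k`, an equitable `k`-coloring always exists
  (`equitablyColorable_of_le_mul`). It suffices to cut an `M × n` grid into `k` subsets of rows and
  columns of sizes `q` and `q + 1`. Choose the number `t` of classes in each row; the remaining
  `w = k - M t` classes lie in the first `w` columns and contain `C` cells in total, spread evenly
  over rows and columns. The admissible `C` form an interval whose end points are compared in
  `exists_grid_parameters`.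
* If `(M + 1) k < M n`, the average class size exceeds `M + 1`, so every class lies inside one part.
  Hence `k` colors suffice equitably iff for some `s ≥ M + 1` every `x i` can be cut into `K i`
  classes of sizes `s` and `s + 1`, with `∑ K i = k`. The possible `K i` are the integers from
  `⌈x i / (s + 1)⌉` to `⌊x i / s⌋`, so this holds iff none of these ranges is empty and `k` lies in
  `I s = [∑ ⌈x i / (s + 1)⌉, ∑ ⌊x i / s⌋]`.

In the first case of the theorem `⌊M n / (M + 1)⌋` lies in no `I s`. In the second case the intervals
`I (M + 1), …, I (h - 1)` follow each other without a gap, because at most one `x i / s` has to be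
rounded, while the integer below `I (h - 1)` is missed by every interval.
-/

open Finset

variable {r : ℕ} {m : Fin r → ℕ} {n : ℕ}

/-! ### Equitable partitions and colorings -/

/-- If `N / w` lies between `q` and `q + 1`, each residue class mod `w` has `q` or `q + 1` elements
below `N`. -/
lemma card_range_filter_mod_eq {q w N b : ℕ} (hb : b < w) (h₁ : q * w ≤ N)
    (h₂ : N ≤ (q + 1) * w) :
    q ≤ #{p ∈ range N | p % w = b} ∧ #{p ∈ range N | p % w = b} ≤ q + 1 := by
  have hw : 0 < w := by lia
  have key : #{p ∈ range N | p % w = b} = N / w + if b < N % w then 1 else 0 := by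
    have := Nat.count_modEq_card N hw b
    rw [Nat.count_eq_card_filter_range, Nat.mod_eq_of_lt hb] at this
    rw [← this]
    simp only [Nat.ModEq, Nat.mod_eq_of_lt hb]
  have h₃ : q ≤ N / w := (Nat.le_div_iff_mul_le hw).2 h₁
  rw [key]
  refine ⟨by lia, ?_⟩
  split_ifs with h
  · suffices N / w < q + 1 by lia
    rw [Nat.div_lt_iff_lt_mul hw]
    refine lt_of_le_of_ne h₂ fun hN => ?_
    simp [hN] at h
  · have : N / w ≤ q + 1 := Nat.div_le_of_le_mul (by lia)
    lia

/-- A finite type can be cut into `t` classes of sizes `q` and `q + 1` as soon as its cardinality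
lies between `q * t` and `(q + 1) * t`. -/
lemma exists_fin_map_fiber_card {X : Type*} [Fintype X] {q t : ℕ}
    (h₁ : q * t ≤ Fintype.card X) (h₂ : Fintype.card X ≤ (q + 1) * t) :
    ∃ f : X → Fin t, ∀ j, q ≤ #{x | f x = j} ∧ #{x | f x = j} ≤ q + 1 := by
  rcases Nat.eq_zero_or_pos t with rfl | ht
  · have : IsEmpty X := Fintype.card_eq_zero_iff.1 (by simpa using h₂)
    exact ⟨isEmptyElim, fun j => j.elim0⟩
  let e := Fintype.equivFin X
  refine ⟨fun x => ⟨e x % t, Nat.mod_lt _ ht⟩, fun j => ?_⟩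
  have : #{x | (⟨e x % t, Nat.mod_lt _ ht⟩ : Fin t) = j}
      = #{p ∈ range (Fintype.card X) | p % t = j} := by
    refine card_bij (fun x _ => (e x : ℕ)) ?_ ?_ ?_
    · intro x hx
      simpa [Fin.ext_iff] using hx
    · intro x _ y _ h
      exact e.injective (Fin.ext h)
    · intro p hp
      rw [mem_filter, mem_range] at hp
      exact ⟨e.symm ⟨p, hp.1⟩, by simp [Fin.ext_iff, hp.2], by simp⟩
  rw [this]
  exact card_range_filter_mod_eq j.2 h₁ h₂

/-- To color equitably, any color type will do, and it suffices that the class sizes are `q` and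
`q + 1` for some `q`. -/
lemma SimpleGraph.EquitablyColorable.of_fiber_card {V α : Type*} [Fintype V] [Fintype α]
    [DecidableEq α] {G : SimpleGraph V} {q : ℕ} (f : V → α) (hf : ∀ v w, G.Adj v w → f v ≠ f w)
    (hq : ∀ a, q ≤ #{v | f v = a} ∧ #{v | f v = a} ≤ q + 1) :
    G.EquitablyColorable (Fintype.card α) := by
  let e := Fintype.equivFin α
  let C : G.Coloring (Fin (Fintype.card α)) :=
    SimpleGraph.Coloring.mk (fun v => e (f v)) fun {v w} h h' => hf v w h (e.injective h')
  have hC : ∀ a, (C.colorClass a).ncard = #{v | f v = e.symm a} := fun a => by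
    rw [← Set.ncard_coe_finset]
    congr 1
    ext v
    simp only [coe_filter, mem_univ, true_and, Set.mem_ofPred_eq, Equiv.eq_symm_apply]
    rfl
  refine ⟨C, fun a b => ?_⟩
  rw [hC, hC]
  have := hq (e.symm a)
  have := hq (e.symm b)
  lia

/-! ### Colorings of the grid with at least `Mn / (M + 1)` colors -/

/-- The cells of `D` are colored by columns, and the rest of each row is cut into `t` classes. -/
lemma exists_grid_map_of_column_cells {M n q t w : ℕ} (D : Finset (Fin M × Fin n))
    (hD : ∀ v ∈ D, (v.2 : ℕ) < w)
    (hrow : ∀ i, #{v ∈ D | v.1 = i} + q * t ≤ n ∧ n ≤ #{v ∈ D | v.1 = i} + (q + 1) * t)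
    (hcol : ∀ b < w, q ≤ #{v ∈ D | (v.2 : ℕ) = b} ∧ #{v ∈ D | (v.2 : ℕ) = b} ≤ q + 1) :
    ∃ f : Fin M × Fin n → (Fin M × Fin t) ⊕ Fin w,
      (∀ u v, f u = f v → u.1 = v.1 ∨ u.2 = v.2) ∧
        ∀ a, q ≤ #{v | f v = a} ∧ #{v | f v = a} ≤ q + 1 := by
  have hcard : ∀ i, Fintype.card {y // (i, y) ∉ D} + #{v ∈ D | v.1 = i} = n := fun i => by
    have h₁ : #{v ∈ D | v.1 = i} = #{y | (i, y) ∈ D} :=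
      card_bij' (fun v _ => v.2) (fun y _ => (i, y)) (by rintro ⟨_, _⟩; simp; rintro h rfl; exact h)
        (by simp) (by rintro ⟨_, _⟩; simp; tauto) (by simp)
    rw [Fintype.card_subtype, h₁, add_comm, card_filter_add_card_filter_not]
    simp
  choose g hg using fun i : Fin M => exists_fin_map_fiber_card (X := {y // (i, y) ∉ D}) (q := q)
    (t := t) (by have := hcard i; have := hrow i; lia) (by have := hcard i; have := hrow i; lia)
  let f : Fin M × Fin n → (Fin M × Fin t) ⊕ Fin w := fun v =>
    if h : v ∈ D then .inr ⟨v.2, hD v h⟩ else .inl (v.1, g v.1 ⟨v.2, h⟩)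
  have hf₁ : ∀ v (h : v ∈ D), f v = .inr ⟨v.2, hD v h⟩ := fun v h => dif_pos h
  have hf₂ : ∀ v (h : v ∉ D), f v = .inl (v.1, g v.1 ⟨v.2, h⟩) := fun v h => dif_neg h
  refine ⟨f, fun u v huv => ?_, ?_⟩
  · by_cases hu : u ∈ D <;> by_cases hv : v ∈ D
    · rw [hf₁ u hu, hf₁ v hv] at huv
      simp only [Sum.inr.injEq, Fin.mk.injEq] at huv
      exact .inr (Fin.ext huv)
    · simp [hf₁ u hu, hf₂ v hv] at huv
    · simp [hf₁ v hv, hf₂ u hu] at huv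
    · rw [hf₂ u hu, hf₂ v hv] at huv
      simp only [Sum.inl.injEq, Prod.mk.injEq] at huv
      exact .inl huv.1
  · rintro (⟨i, j⟩ | b)
    · have : #{y | g i y = j} = #{v | f v = .inl (i, j)} := by
        refine card_bij (fun y _ => (i, y.1)) ?_ ?_ ?_
        · rintro ⟨y, hy⟩ h
          simpa [hf₂ (i, y) hy] using h
        · rintro ⟨y, hy⟩ _ ⟨z, hz⟩ _ h
          simpa using h
        · rintro ⟨i', y⟩ h
          by_cases hv : (i', y) ∈ D
          · simp [hf₁ _ hv] at h
          · simp only [mem_filter, mem_univ, hf₂ _ hv, Sum.inl.injEq, Prod.mk.injEq,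
              true_and] at h
            obtain ⟨rfl, h⟩ := h
            exact ⟨⟨y, hv⟩, by simpa using h, rfl⟩
      rw [← this]
      exact hg i j
    · have : ({v | f v = .inr b} : Finset _) = {v ∈ D | (v.2 : ℕ) = b} := by
        ext v
        by_cases hv : v ∈ D
        · simp [hf₁ v hv, hv, Fin.ext_iff]
        · simp [hf₂ v hv, hv]
      rw [this]
      exact hcol b b.2

/-- `C` cells can be spread evenly both over the `M` rows and over the first `w` columns. -/
lemma exists_balanced_cells {M n w C : ℕ} (hw : w ≤ n) (hC : C ≤ M * w) :
    ∃ D : Finset (Fin M × Fin n), (∀ v ∈ D, (v.2 : ℕ) < w) ∧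
      (∀ i l, M * l ≤ C → l ≤ #{v ∈ D | v.1 = i}) ∧
      (∀ i l, C ≤ M * l → #{v ∈ D | v.1 = i} ≤ l) ∧
      ∀ q b, b < w → q * w ≤ C → C ≤ (q + 1) * w →
        q ≤ #{v ∈ D | (v.2 : ℕ) = b} ∧ #{v ∈ D | (v.2 : ℕ) = b} ≤ q + 1 := by
  have hmod : ∀ p : Fin C, (p : ℕ) % w < w := fun p =>
    Nat.mod_lt _ (Nat.pos_of_ne_zero fun h => by have := p.2; simp [h] at hC; lia)
  -- Consecutive blocks of cells form the rows, while the columns are taken cyclically.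
  -- Two cells of one block are less than `w` apart, so they lie in different columns.
  let φ : Fin C → Fin M × Fin n := fun p =>
    (⟨p * M / C, Nat.div_lt_of_lt_mul (by
        have := p.2
        have : 0 < M := Nat.pos_of_ne_zero fun h => by simp [h] at hC; lia
        exact Nat.mul_lt_mul_of_pos_right p.2 this)⟩, ⟨p % w, (hmod p).trans_le hw⟩)
  have hlt : ∀ p p' : Fin C, (p : ℕ) ≤ p' → φ p = φ p' → p = p' := fun p p' hle h => by
    simp only [φ, Prod.mk.injEq, Fin.mk.injEq] at h
    obtain ⟨h₁, h₂⟩ := h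
    have hC0 : 0 < C := by have := p.2; lia
    have a₁ := Nat.div_mul_le_self (p * M) C
    have a₂ := Nat.lt_div_mul_add (a := p' * M) hC0
    rw [← h₁] at a₂
    have a₃ : (p' : ℕ) * M < (p + w) * M := by linarith
    have a₄ : (p' : ℕ) - p < w := by
      have := Nat.lt_of_mul_lt_mul_right a₃
      lia
    have a₅ : w ∣ (p' : ℕ) - p := (Nat.modEq_iff_dvd' hle).1 h₂
    have := Nat.eq_zero_of_dvd_of_lt a₅ a₄
    exact Fin.ext (by lia)
  have hφ : Function.Injective φ := fun p p' h => by
    rcases le_total (p : ℕ) p' with hle | hle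
    · exact hlt p p' hle h
    · exact (hlt p' p hle h.symm).symm
  have hcount : ∀ P : Fin M × Fin n → Prop, ∀ Q : ℕ → Prop, [DecidablePred P] →
      [DecidablePred Q] → (∀ p, P (φ p) ↔ Q p) →
      #{v ∈ univ.map ⟨φ, hφ⟩ | P v} = #{p ∈ range C | Q p} := fun P Q _ _ h => by
    rw [filter_map, card_map]
    refine card_bij (fun p _ => (p : ℕ)) ?_ ?_ ?_
    · intro p hp
      simpa [h] using hp
    · intro p _ p' _ h
      exact Fin.ext h
    · intro p hp
      rw [mem_filter, mem_range] at hp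
      exact ⟨⟨p, hp.1⟩, by simp [h, hp.2], rfl⟩
  have hrow : ∀ i : Fin M, #{v ∈ univ.map ⟨φ, hφ⟩ | v.1 = i}
      = (((i + 1) * C) ⌈/⌉ M) - ((i * C) ⌈/⌉ M) := fun i => by
    have hM : 0 < M := by have := i.2; lia
    rw [hcount (fun v => v.1 = i) (fun p => p * M / C = i) fun p => by simp [φ, Fin.ext_iff],
      ← Nat.card_Ico]
    congr 1
    ext p
    rw [mem_filter, mem_range, mem_Ico, ceilDiv_le_iff_le_mul hM,
      lt_iff_not_ge (a := p) (b := ((i + 1) * C) ⌈/⌉ M),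
      ceilDiv_le_iff_le_mul hM, not_le]
    have hi : (i + 1) * C ≤ M * C := Nat.mul_le_mul_right _ i.2
    rcases Nat.eq_zero_or_pos C with rfl | hC0
    · simp
    rw [add_one_mul] at hi ⊢
    constructor
    · rintro ⟨_, h⟩
      rw [Nat.div_eq_iff hC0] at h
      rw [mul_comm M p]
      constructor <;> omega
    · rintro ⟨h₁, h₂⟩
      refine ⟨Nat.lt_of_mul_lt_mul_left (h₂.trans_le hi), ?_⟩
      rw [Nat.div_eq_iff hC0, mul_comm p M]
      constructor <;> omega
  refine ⟨univ.map ⟨φ, hφ⟩, ?_, fun i l hl => ?_, fun i l hl => ?_, fun q b hb h₁ h₂ => ?_⟩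
  · simp only [mem_map, mem_univ, true_and, Function.Embedding.coeFn_mk]
    rintro _ ⟨p, rfl⟩
    exact hmod p
  · have hM : 0 < M := by have := i.2; lia
    rw [hrow]
    apply Nat.le_sub_of_add_le
    by_contra! h
    have h₁ : (i + 1) * C ≤ M * (((i + 1) * C) ⌈/⌉ M) := (ceilDiv_le_iff_le_mul hM).1 le_rfl
    have h₂ : (i * C) ⌈/⌉ M ≤ ((i + 1) * C) ⌈/⌉ M - l := by
      rw [ceilDiv_le_iff_le_mul hM, Nat.mul_sub]
      lia
    have h₃ : l ≤ ((i + 1) * C) ⌈/⌉ M := by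
      by_contra! h₃
      have := Nat.mul_lt_mul_of_pos_left h₃ hM
      lia
    lia
  · have hM : 0 < M := by have := i.2; lia
    rw [hrow]
    suffices ((i + 1) * C) ⌈/⌉ M ≤ (i * C) ⌈/⌉ M + l by lia
    have h₁ : i * C ≤ M * ((i * C) ⌈/⌉ M) := (ceilDiv_le_iff_le_mul hM).1 le_rfl
    rw [ceilDiv_le_iff_le_mul hM]
    lia
  · rw [hcount (fun v => (v.2 : ℕ) = b) (fun p => p % w = b) fun p => by simp [φ]]
    exact card_range_filter_mod_eq hb h₁ h₂

/-- The parameters of a coloring of the `M × n` grid by `k` classes of sizes `q` and `q + 1`: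
`t` classes in each row, one class in each of `w` columns, and `C` cells in the column classes. -/
lemma exists_grid_parameters {M n k : ℕ} (hM : 0 < M) (hMn : M ≤ n) (hk : M * n ≤ (M + 1) * k) :
    ∃ q t w C, M * t + w = k ∧ w ≤ n ∧ C ≤ M * w ∧ q * w ≤ C ∧ C ≤ (q + 1) * w ∧
      M * n ≤ C + M * ((q + 1) * t) ∧ C + M * (q * t) ≤ M * n := by
  rcases lt_or_ge k n with hkn | hnk
  · -- Here all column classes are full columns.
    obtain ⟨d, rfl⟩ : ∃ d, n = k + d := ⟨n - k, by lia⟩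
    obtain ⟨e, rfl⟩ : ∃ e, k = M * d + e := ⟨k - M * d, by lia⟩
    exact ⟨M, d, e, M * e, rfl, by lia, le_rfl, le_rfl, by lia, by lia, by lia⟩
  · have hn : 0 < n := by lia
    have hk0 : 0 < k := by lia
    have hMn0 : 0 < M * n := Nat.mul_pos hM hn
    obtain ⟨q, hq₁, hq₂⟩ : ∃ q, q * k < M * n ∧ M * n ≤ (q + 1) * k := by
      refine ⟨(M * n - 1) / k, ?_, ?_⟩
      · have := Nat.div_mul_le_self (M * n - 1) k
        lia
      · have := Nat.lt_div_mul_add (a := M * n - 1) hk0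
        lia
    have hqM : q < M := by
      have := Nat.mul_le_mul_left M hnk
      exact Nat.lt_of_mul_lt_mul_right (hq₁.trans_le this)
    obtain ⟨t, ht₁, ht₂, ht₃⟩ : ∃ t, q * t ≤ n ∧ M * t ≤ k ∧ k ≤ M * t + n := by
      have hk₁ := Nat.mul_div_le k M
      have hk₂ := Nat.lt_mul_div_succ k hM
      by_cases h : q * (k / M) ≤ n
      · exact ⟨k / M, h, hk₁, by lia⟩
      · have hq0 : 0 < q := Nat.pos_of_ne_zero fun h0 => by simp [h0] at h
        have hn₁ := Nat.mul_div_le n q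
        have hn₂ := Nat.lt_mul_div_succ n hq0
        have hle : n / q ≤ k / M := by
          by_contra! hlt
          exact h ((Nat.mul_le_mul_left q hlt.le).trans hn₁)
        refine ⟨n / q, hn₁, (Nat.mul_le_mul_left M hle).trans hk₁, ?_⟩
        -- `q * (k - M * t) ≤ M * (n - q * t) < M * q`, hence `k - M * t < M ≤ n`.
        have h₁ : M * n < M * (q * (n / q + 1)) := Nat.mul_lt_mul_of_pos_left hn₂ hM
        have h₂ : q * k < q * (M * (n / q) + M) := by
          calc q * k = k * q := mul_comm _ _
            _ < M * (q * (n / q + 1)) := by rw [mul_comm k q]; lia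
            _ = _ := by ring
        have := Nat.lt_of_mul_lt_mul_left h₂
        lia
    obtain ⟨w, rfl⟩ : ∃ w, k = M * t + w := ⟨k - M * t, by lia⟩
    have e₁ : q * (M * t + w) = M * (q * t) + q * w := by ring
    have e₂ : (q + 1) * (M * t + w) = M * ((q + 1) * t) + (q + 1) * w := by ring
    have e₃ : M * ((q + 1) * t) = M * (q * t) + M * t := by ring
    have e₄ : (q + 1) * w = q * w + w := by ring
    have e₅ : (q + 1) * w ≤ M * w := Nat.mul_le_mul_right w hqM
    have e₆ : M * (q * t) ≤ M * n := Nat.mul_le_mul_left M ht₁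
    exact ⟨q, t, w, max (M * n - M * ((q + 1) * t)) (q * w), rfl, by lia, by lia, by lia, by lia,
      by lia, by lia⟩

/-- The coloring of the grid by row and column classes. Equal colors force equal rows or equal
columns. -/
lemma exists_grid_map {M n k : ℕ} (hM : 0 < M) (hMn : M ≤ n) (hk : M * n ≤ (M + 1) * k) :
    ∃ q t w, M * t + w = k ∧ ∃ f : Fin M × Fin n → (Fin M × Fin t) ⊕ Fin w,
      (∀ u v, f u = f v → u.1 = v.1 ∨ u.2 = v.2) ∧
        ∀ a, q ≤ #{v | f v = a} ∧ #{v | f v = a} ≤ q + 1 := by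
  obtain ⟨q, t, w, C, h₁, h₂, h₃, h₄, h₅, h₆, h₇⟩ := exists_grid_parameters hM hMn hk
  obtain ⟨D, hD₁, hD₂, hD₃, hD₄⟩ := exists_balanced_cells h₂ h₃
  refine ⟨q, t, w, h₁, exists_grid_map_of_column_cells D hD₁ (fun i => ⟨?_, ?_⟩)
    fun b hb => hD₄ q b hb h₄ h₅⟩
  · have hle : q * t ≤ n := Nat.le_of_mul_le_mul_left (by lia) hM
    have := hD₃ i (n - q * t) (by rw [Nat.mul_sub]; lia)
    lia
  · have := hD₂ i (n - (q + 1) * t) (by rw [Nat.mul_sub]; lia)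
    lia


lemma multipartiteTimesComplete_adj {u v : (Σ i, Fin (m i)) × Fin n} :
    (multipartiteTimesComplete m n).Adj u v ↔ u.1.1 ≠ v.1.1 ∧ u.2 ≠ v.2 :=
  Iff.rfl

/-- The product graph is a subgraph of `K_M × K_n`, whose independent sets are the subsets of rows and
columns of the grid. -/
theorem equitablyColorable_of_le_mul {k : ℕ} (hM : 0 < ∑ i, m i) (hMn : ∑ i, m i ≤ n)
    (hk : (∑ i, m i) * n ≤ (∑ i, m i + 1) * k) :
    (multipartiteTimesComplete m n).EquitablyColorable k := by
  obtain ⟨q, t, w, rfl, f, hf₁, hf₂⟩ := exists_grid_map hM hMn hk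
  let e : (Σ i, Fin (m i)) ≃ Fin (∑ i, m i) := finSigmaFinEquiv
  have := SimpleGraph.EquitablyColorable.of_fiber_card (G := multipartiteTimesComplete m n)
    (q := q) (fun v => f (e v.1, v.2)) (fun u v huv h => ?_) fun a => ?_
  · simpa using this
  · rw [multipartiteTimesComplete_adj] at huv
    rcases hf₁ _ _ h with h | h
    · exact huv.1 (congrArg Sigma.fst (e.injective h))
    · exact huv.2 h
  · have : #{v : (Σ i, Fin (m i)) × Fin n | f (e v.1, v.2) = a} = #{v | f v = a} :=
      card_equiv (e.prodCongr (Equiv.refl _)) (by simp)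
    rw [this]
    exact hf₂ a

/-! ### Colorings whose classes lie inside the parts -/

theorem equitablyColorable_of_partwise {s : ℕ} (k : Fin r → ℕ)
    (hk : ∀ i, s * k i ≤ m i * n ∧ m i * n ≤ (s + 1) * k i) :
    (multipartiteTimesComplete m n).EquitablyColorable (∑ i, k i) := by
  choose g hg using fun i => exists_fin_map_fiber_card (X := Fin (m i) × Fin n) (q := s)
    (t := k i) (by simpa using (hk i).1) (by simpa using (hk i).2)
  have := SimpleGraph.EquitablyColorable.of_fiber_card (G := multipartiteTimesComplete m n)
    (q := s) (fun v => (⟨v.1.1, g v.1.1 (v.1.2, v.2)⟩ : Σ i, Fin (k i))) (fun u v huv h => ?_)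
    fun a => ?_
  · simpa using this
  · rw [multipartiteTimesComplete_adj] at huv
    exact huv.1 (Sigma.mk.inj_iff.1 h).1
  · obtain ⟨i, j⟩ := a
    have : #{y | g i y = j} = #{v : (Σ i, Fin (m i)) × Fin n |
        (⟨v.1.1, g v.1.1 (v.1.2, v.2)⟩ : Σ i, Fin (k i)) = ⟨i, j⟩} := by
      refine card_bij (fun y _ => (⟨i, y.1⟩, y.2)) ?_ ?_ ?_
      · rintro ⟨a, y⟩ h
        simpa using h
      · rintro ⟨a, y⟩ _ ⟨b, z⟩ _ h
        simpa using h
      · rintro ⟨⟨i', a⟩, y⟩ h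
        simp only [mem_filter, mem_univ, true_and, Sigma.mk.injEq] at h
        obtain ⟨rfl, h⟩ := h
        exact ⟨(a, y), by simpa using h, rfl⟩
    rw [← this]
    exact hg i j

/-- An independent set with more vertices than a column lies inside one part. -/
lemma exists_part_of_card_lt {S : Finset ((Σ i, Fin (m i)) × Fin n)}
    (hS : ∀ u ∈ S, ∀ v ∈ S, ¬ (multipartiteTimesComplete m n).Adj u v)
    (hcard : ∑ i, m i < #S) : ∃ i, ∀ v ∈ S, v.1.1 = i := by
  simp only [multipartiteTimesComplete_adj, not_and_or, not_not] at hS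
  have hne : S.Nonempty := card_pos.1 (by lia)
  obtain ⟨u, hu⟩ := hne
  refine ⟨u.1.1, ?_⟩
  by_contra! hv
  obtain ⟨v, hv, huv⟩ := hv
  have h₁ : u.2 = v.2 := (hS u hu v hv).resolve_left huv.symm
  have h₂ : ∀ x ∈ S, x.2 = u.2 := fun x hx => by
    by_contra hxu
    have a₁ := (hS x hx u hu).resolve_right hxu
    have a₂ := (hS x hx v hv).resolve_right (by rwa [← h₁])
    exact huv (a₂.symm.trans a₁)
  have : #S ≤ #(univ : Finset (Σ i, Fin (m i))) :=
    card_le_card_of_injOn Prod.fst (fun _ _ => mem_univ _) fun x hx y hy hxy =>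
      Prod.ext hxy ((h₂ x hx).trans (h₂ y hy).symm)
  rw [card_univ, Fintype.card_sigma] at this
  simp only [Fintype.card_fin] at this
  lia

/-- With fewer than `Mn / (M + 1)` colors, every class of an equitable coloring has more than `M`
elements, so the parts are colored separately. -/
theorem exists_partwise_of_equitablyColorable {k : ℕ}
    (hk : (∑ i, m i + 1) * k < (∑ i, m i) * n)
    (h : (multipartiteTimesComplete m n).EquitablyColorable k) :
    ∃ s, ∑ i, m i + 1 ≤ s ∧ ∃ K : Fin r → ℕ, ∑ i, K i = k ∧
      ∀ i, s * K i ≤ m i * n ∧ m i * n ≤ (s + 1) * K i := by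
  classical
  obtain ⟨C, hC⟩ := h
  set M := ∑ i, m i with hM
  let S : Fin k → Finset ((Σ i, Fin (m i)) × Fin n) := fun a => {v | C v = a}
  have hS : ∀ a, (C.colorClass a).ncard = #(S a) := fun a => by
    rw [← Set.ncard_coe_finset]
    congr 1
    ext v
    simp [S, SimpleGraph.Coloring.colorClass]
  simp only [hS] at hC
  have htotal : ∑ a, #(S a) = M * n := by
    rw [← card_eq_sum_card_fiberwise (f := C) (t := univ) (fun _ _ => mem_univ _)]
    simp [hM]
  have hk0 : 0 < k := by
    rcases Nat.eq_zero_or_pos k with rfl | h0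
    · simp only [univ_eq_empty, sum_empty] at htotal
      lia
    · exact h0
  have : Nonempty (Fin k) := ⟨⟨0, hk0⟩⟩
  obtain ⟨a₀, -, ha₀⟩ := exists_min_image univ (fun a => #(S a)) univ_nonempty
  set s := #(S a₀) with hs
  have hlo : ∀ a, s ≤ #(S a) := fun a => ha₀ a (mem_univ a)
  have hhi : ∀ a, #(S a) ≤ s + 1 := fun a => hC a a₀
  have hMs : M < s := by
    have h₁ : M * n ≤ k * (s + 1) := by
      rw [← htotal]
      simpa using sum_le_card_nsmul univ (fun a => #(S a)) (s + 1) fun a _ => hhi a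
    rw [mul_comm k] at h₁
    have := Nat.lt_of_mul_lt_mul_right (hk.trans_le h₁)
    lia
  choose π hπ using fun a => exists_part_of_card_lt (S := S a)
    (fun u hu v hv huv => C.valid huv (by
      simp only [S, mem_filter, mem_univ, true_and] at hu hv
      rw [hu, hv])) (hMs.trans_le (hlo a))
  refine ⟨s, hMs, fun i => #{a | π a = i}, ?_, fun i => ?_⟩
  · rw [← card_eq_sum_card_fiberwise (fun _ _ => mem_univ _)]
    simp
  · have hpart : m i * n = ∑ a with π a = i, #(S a) := by
      have h₁ : #(univ : Finset (Fin (m i) × Fin n)) =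
          #{v : (Σ i, Fin (m i)) × Fin n | v.1.1 = i} := by
        refine card_bij (fun y _ => (⟨i, y.1⟩, y.2)) (by simp) ?_ ?_
        · rintro ⟨a, y⟩ _ ⟨b, z⟩ _ h
          simpa using h
        · rintro ⟨⟨i', a⟩, y⟩ h
          simp only [mem_filter, mem_univ, true_and] at h
          subst h
          exact ⟨(a, y), mem_univ _, rfl⟩
      have h₂ : #(univ : Finset (Fin (m i) × Fin n)) = m i * n := by simp
      have hmem : ∀ v : (Σ i, Fin (m i)) × Fin n, π (C v) = v.1.1 := fun v =>
        (hπ (C v) v (by simp [S])).symm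
      rw [← h₂, h₁, card_eq_sum_card_fiberwise (f := C) (t := {a | π a = i})]
      · refine sum_congr rfl fun a ha => ?_
        congr 1
        ext v
        simp only [mem_filter, mem_univ, true_and, S, and_iff_right_iff_imp] at ha ⊢
        rintro rfl
        rw [← hmem, ha]
      · intro v hv
        simpa [hmem] using hv
    rw [hpart]
    constructor
    · rw [mul_comm]
      simpa using card_nsmul_le_sum {a | π a = i} (fun a => #(S a)) s fun a _ => hlo a
    · rw [mul_comm]
      simpa using sum_le_card_nsmul {a | π a = i} (fun a => #(S a)) (s + 1) fun a _ => hhi a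

/-! ### Reduction to intervals of integers -/

lemma exists_sum_eq_of_le_of_le {ι : Type*} [Fintype ι] {a b : ι → ℕ} (hab : ∀ i, a i ≤ b i)
    {k : ℕ} (hak : ∑ i, a i ≤ k) (hkb : k ≤ ∑ i, b i) :
    ∃ K : ι → ℕ, ∑ i, K i = k ∧ ∀ i, a i ≤ K i ∧ K i ≤ b i := by
  classical
  induction k, hak using Nat.le_induction with
  | base => exact ⟨a, rfl, fun i => ⟨le_rfl, hab i⟩⟩
  | succ k _ ih =>
    obtain ⟨K, hK, hKab⟩ := ih (by lia)
    obtain ⟨i, -, hi⟩ : ∃ i ∈ univ, K i < b i := exists_lt_of_sum_lt (by lia)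
    refine ⟨Function.update K i (K i + 1), ?_, fun j => ?_⟩
    · rw [sum_update_of_mem (mem_univ i), ← hK, ← add_sum_erase univ K (mem_univ i),
        sdiff_singleton_eq_erase]
      ring
    · have := hKab j
      by_cases hj : j = i
      · subst hj
        simp only [Function.update_self]
        lia
      · simpa [hj] using this

/-- The numbers `k` for which all `x i` can be cut into pieces of sizes `s` and `s + 1`, with `k` pieces
in total, form an interval. -/
lemma exists_partwise_iff {ι : Type*} [Fintype ι] {x : ι → ℕ} {s k : ℕ} (hs : 0 < s) :
    (∃ K : ι → ℕ, ∑ i, K i = k ∧ ∀ i, s * K i ≤ x i ∧ x i ≤ (s + 1) * K i) ↔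
      (∀ i, x i ⌈/⌉ (s + 1) ≤ x i / s) ∧ ∑ i, x i ⌈/⌉ (s + 1) ≤ k ∧ k ≤ ∑ i, x i / s := by
  have key : ∀ i c, s * c ≤ x i ∧ x i ≤ (s + 1) * c ↔ x i ⌈/⌉ (s + 1) ≤ c ∧ c ≤ x i / s :=
    fun i c => by
      rw [ceilDiv_le_iff_le_mul (Nat.succ_pos s), Nat.le_div_iff_mul_le hs, mul_comm c s, and_comm]
  simp only [key]
  constructor
  · rintro ⟨K, rfl, hK⟩
    exact ⟨fun i => (hK i).1.trans (hK i).2, sum_le_sum fun i _ => (hK i).1,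
      sum_le_sum fun i _ => (hK i).2⟩
  · rintro ⟨h, h₁, h₂⟩
    exact exists_sum_eq_of_le_of_le h h₁ h₂

theorem equitablyColorable_of_mem_interval {s k : ℕ} (hs : 0 < s)
    (h : ∀ i, (m i * n) ⌈/⌉ (s + 1) ≤ m i * n / s)
    (h₁ : ∑ i, (m i * n) ⌈/⌉ (s + 1) ≤ k) (h₂ : k ≤ ∑ i, m i * n / s) :
    (multipartiteTimesComplete m n).EquitablyColorable k := by
  obtain ⟨K, rfl, hK⟩ := (exists_partwise_iff (x := fun i => m i * n) hs).2 ⟨h, h₁, h₂⟩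
  exact equitablyColorable_of_partwise K hK

theorem exists_mem_interval_of_equitablyColorable {k : ℕ}
    (hk : (∑ i, m i + 1) * k < (∑ i, m i) * n)
    (h : (multipartiteTimesComplete m n).EquitablyColorable k) :
    ∃ s, ∑ i, m i + 1 ≤ s ∧ (∀ i, (m i * n) ⌈/⌉ (s + 1) ≤ m i * n / s) ∧
      ∑ i, (m i * n) ⌈/⌉ (s + 1) ≤ k ∧ k ≤ ∑ i, m i * n / s := by
  obtain ⟨s, hs, hK⟩ := exists_partwise_of_equitablyColorable hk h
  exact ⟨s, hs, (exists_partwise_iff (x := fun i => m i * n) (by lia)).1 hK⟩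

lemma SimpleGraph.isEquitableChromaticThreshold_of_not {V : Type*} [Finite V] {G : SimpleGraph V}
    {t : ℕ} (h : ∀ k, t ≤ k → G.EquitablyColorable k) (h' : ¬ G.EquitablyColorable (t - 1)) :
    G.IsEquitableChromaticThreshold t := by
  refine ⟨h, fun s hs => ?_⟩
  by_contra! hst
  exact h' (hs _ (by lia))

/-! ### Sums of rounded quotients -/

lemma ceilDiv_le_ceilDiv_left {a s t : ℕ} (hs : 0 < s) (hst : s ≤ t) : a ⌈/⌉ t ≤ a ⌈/⌉ s := by
  rw [ceilDiv_le_iff_le_mul (hs.trans_le hst)]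
  exact ((ceilDiv_le_iff_le_mul hs).1 le_rfl).trans (Nat.mul_le_mul_right _ hst)

lemma ceilDiv_eq_div_add_ite {a t : ℕ} (ht : 0 < t) :
    a ⌈/⌉ t = a / t + if t ∣ a then 0 else 1 := by
  have hlt := Nat.lt_mul_div_succ a ht
  apply le_antisymm
  · rw [ceilDiv_le_iff_le_mul ht]
    split_ifs with h
    · exact (Nat.mul_div_cancel' h).ge
    · exact hlt.le
  · have hle : a ≤ t * (a ⌈/⌉ t) := (ceilDiv_le_iff_le_mul ht).1 le_rfl
    have h₁ : a / t ≤ a ⌈/⌉ t := Nat.div_le_of_le_mul hle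
    split_ifs with h
    · exact h₁
    · refine Nat.succ_le_of_lt (h₁.lt_of_ne fun heq => h ⟨a / t, ?_⟩)
      rw [← heq] at hle
      exact hle.antisymm (Nat.mul_div_le a t)

lemma sum_ceilDiv_eq {ι : Type*} [Fintype ι] {x : ι → ℕ} {t : ℕ} (ht : 0 < t) :
    ∑ i, x i ⌈/⌉ t = ∑ i, x i / t + #{i | ¬ t ∣ x i} := by
  simp only [ceilDiv_eq_div_add_ite ht, sum_add_distrib, card_filter, ite_not]

lemma div_succ_lt_ceilDiv {a t : ℕ} (ha : 0 < a) (ht : 0 < t) : a / (t + 1) < a ⌈/⌉ t := by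
  by_contra! h
  rw [ceilDiv_le_iff_le_mul ht] at h
  have h₁ := Nat.mul_div_le a (t + 1)
  rw [add_one_mul] at h₁
  have h₂ : a / (t + 1) = 0 := by lia
  simp [h₂] at h
  lia

lemma sum_mul_eq_mul : ∑ i, m i * n = (∑ i, m i) * n := (sum_mul _ _ _).symm

lemma mul_sum_div_le (t : ℕ) : t * ∑ i, m i * n / t ≤ (∑ i, m i) * n := by
  rw [← sum_mul_eq_mul, mul_sum]
  exact sum_le_sum fun i _ => Nat.mul_div_le _ _

/-! ### The two cases -/

/-- The threshold when `⌊M n / (M + 1)⌋` colors do not suffice. The hypothesis excludes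
`M + 1 ∣ n`, and `M + 1` is coprime to `M`, so `⌈M n / (M + 1)⌉ - 1 = ⌊M n / (M + 1)⌋`. -/
theorem isEquitableChromaticThreshold_ceilDiv (hM : 2 ≤ ∑ i, m i) (hMn : ∑ i, m i ≤ n)
    (h : ∑ i, m i * n / (∑ i, m i + 1) < (∑ i, m i) * n / (∑ i, m i + 1) ∨
      ∃ i, m i * n / (∑ i, m i + 1) < (m i * n) ⌈/⌉ (∑ i, m i + 2)) :
    (multipartiteTimesComplete m n).IsEquitableChromaticThreshold
      (((∑ i, m i) * n) ⌈/⌉ (∑ i, m i + 1)) := by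
  refine SimpleGraph.isEquitableChromaticThreshold_of_not (fun k hk => ?_) fun hcol => ?_
  · rw [ceilDiv_le_iff_le_mul (by lia)] at hk
    exact equitablyColorable_of_le_mul (by lia) hMn hk
  have hsum := mul_sum_div_le (m := m) (n := n)
  have hsum' := sum_mul_eq_mul (m := m) (n := n)
  set M := ∑ i, m i with hMdef
  have hndvd : ¬ M + 1 ∣ n := by
    rintro ⟨c, rfl⟩
    have hdiv : ∀ a, a * ((M + 1) * c) / (M + 1) = a * c := fun a => by
      rw [Nat.mul_left_comm, Nat.mul_div_cancel_left _ (Nat.succ_pos M)]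
    simp only [hdiv] at h
    rcases h with h | ⟨i, h⟩
    · rw [← sum_mul] at h
      lia
    · rw [lt_iff_not_ge, ceilDiv_le_iff_le_mul (by lia)] at h
      apply h
      rw [Nat.mul_left_comm]
      exact Nat.mul_le_mul_right _ (by lia)
  have hndvd' : ¬ M + 1 ∣ M * n := fun hd =>
    hndvd ((Nat.coprime_self_add_left.2 (Nat.coprime_one_left M)).dvd_of_dvd_mul_left hd)
  have hceil := ceilDiv_eq_div_add_ite (a := M * n) (Nat.succ_pos M)
  rw [if_neg hndvd'] at hceil
  rw [Nat.succ_eq_add_one] at hceil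
  rw [hceil, Nat.add_sub_cancel] at hcol
  set F := M * n / (M + 1) with hF
  have hF₁ : (M + 1) * F ≤ M * n := Nat.mul_div_le _ _
  have hF₂ : M * n < (M + 1) * (F + 1) := Nat.lt_mul_div_succ _ (Nat.succ_pos M)
  obtain ⟨s, hs, hgood, -, hup⟩ := exists_mem_interval_of_equitablyColorable
    (hF₁.lt_of_ne fun heq => hndvd' ⟨F, heq.symm⟩) hcol
  have hmono : ∀ t, 0 < t → t ≤ s → ∀ i, m i * n / s ≤ m i * n / t :=
    fun t ht hts i => Nat.div_le_div_left hts ht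
  rcases h with h | ⟨i, hi⟩
  · have := sum_le_sum fun i (_ : i ∈ univ) => hmono (M + 1) (by lia) hs i
    lia
  · have hs' : M + 2 ≤ s := by
      refine Nat.succ_le_of_lt (lt_of_le_of_ne hs ?_)
      rintro rfl
      exact (hgood i).not_gt hi
    have hlt : (M + 2) * F < M * n := by
      calc (M + 2) * F ≤ (M + 2) * ∑ j, m j * n / s := Nat.mul_le_mul_left _ hup
        _ = ∑ j, (M + 2) * (m j * n / s) := mul_sum _ _ _
        _ < ∑ j, m j * n := by
          refine sum_lt_sum (fun j _ => ?_) ⟨i, mem_univ i, ?_⟩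
          · exact (Nat.mul_le_mul_left _ (hmono (M + 2) (by lia) hs' j)).trans
              (Nat.mul_div_le _ _)
          · rw [lt_iff_not_ge, ceilDiv_le_iff_le_mul (by lia)] at hi
            exact (Nat.mul_le_mul_left _ (hmono (M + 1) (by lia) hs i)).trans_lt (not_le.1 hi)
        _ = M * n := hsum'
    -- The bounds `(M + 2) * F < M * n < (M + 1) * (F + 1)` give `F < M`, then `n = M`,
    -- and finally `M ≤ 1`.
    have hFM : F < M := by nlinarith
    have hn : n = M := by
      refine le_antisymm ?_ hMn
      by_contra! hlt'
      nlinarith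
    subst hn
    have hF₃ : M = F + 1 := by
      refine le_antisymm ?_ hFM
      by_contra! hlt'
      nlinarith
    rw [add_mul] at hlt
    have : M * M = M * F + M := by rw [← mul_add_one, ← hF₃]
    lia

/-- The threshold when the interval of `s = M + 1` reaches up to `⌊M n / (M + 1)⌋`: the union of the
intervals of `s = M + 1, …, h - 1` has no gaps, and the number just below it is not attained. -/
theorem exists_isLeast_and_isEquitableChromaticThreshold (hr : 2 ≤ r) (hm : ∀ i, 0 < m i)
    (hn : 0 < n) (hMn : ∑ i, m i ≤ n)
    (h₁ : (∑ i, m i) * n / (∑ i, m i + 1) ≤ ∑ i, m i * n / (∑ i, m i + 1))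
    (h₂ : ∀ i, (m i * n) ⌈/⌉ (∑ i, m i + 2) ≤ m i * n / (∑ i, m i + 1)) :
    ∃ h : ℕ, IsLeast {t : ℕ | ∑ i, m i + 2 ≤ t ∧
        ((∃ i, m i * n / t < (m i * n) ⌈/⌉ (t + 1)) ∨
          ∃ i j, i ≠ j ∧ ¬ t ∣ m i * n ∧ ¬ t ∣ m j * n)} h ∧
      (multipartiteTimesComplete m n).IsEquitableChromaticThreshold
        (∑ i, (m i * n) ⌈/⌉ h) := by
  classical
  have hx : ∀ i, 0 < m i * n := fun i => Nat.mul_pos (hm i) hn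
  let i₀ : Fin r := ⟨0, by lia⟩
  let i₁ : Fin r := ⟨1, by lia⟩
  have h01 : i₀ ≠ i₁ := by simp [i₀, i₁]
  have hMpos : 0 < ∑ i, m i := sum_pos (fun i _ => hm i) ⟨i₀, mem_univ _⟩
  have hsum := mul_sum_div_le (m := m) (n := n)
  have hsum' := sum_mul_eq_mul (m := m) (n := n)
  set M := ∑ i, m i with hMdef
  let P : ℕ → Prop := fun t => M + 2 ≤ t ∧ ((∃ i, m i * n / t < (m i * n) ⌈/⌉ (t + 1)) ∨
    ∃ i j, i ≠ j ∧ ¬ t ∣ m i * n ∧ ¬ t ∣ m j * n)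
  have hP : ∃ t, P t := by
    -- Every large enough `t` divides none of the positive numbers `m i * n`.
    have hlarge : ∀ i, m i * n < M + 2 + M * n := fun i => by
      have := single_le_sum (f := fun i => m i * n) (fun i _ => Nat.zero_le _) (mem_univ i)
      simp only [hsum'] at this
      lia
    exact ⟨M + 2 + M * n, by lia, .inr ⟨i₀, i₁, h01,
      Nat.not_dvd_of_pos_of_lt (hx _) (hlarge _), Nat.not_dvd_of_pos_of_lt (hx _) (hlarge _)⟩⟩
  obtain ⟨h, hh, hleast⟩ : ∃ h, IsLeast {t | P t} h :=
    ⟨Nat.find hP, Nat.find_spec hP, fun t ht => Nat.find_min' hP ht⟩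
  have hhM : M + 2 ≤ h := hh.1
  have hbelow : ∀ t, M + 2 ≤ t → t < h → (∀ i, (m i * n) ⌈/⌉ (t + 1) ≤ m i * n / t) ∧
      ∑ i, (m i * n) ⌈/⌉ t ≤ ∑ i, m i * n / t + 1 := fun t ht hth => by
    have hnot : ¬ P t := fun hPt => hth.not_ge (hleast hPt)
    simp only [P, ht, true_and, not_or, not_exists, not_lt] at hnot
    refine ⟨hnot.1, ?_⟩
    rw [sum_ceilDiv_eq (by lia)]
    refine Nat.add_le_add_left (card_le_one.2 fun i hi j hj => ?_) _
    by_contra hij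
    exact hnot.2 i j ⟨hij, (mem_filter.1 hi).2, (mem_filter.1 hj).2⟩
  have hgood : ∀ s, M + 1 ≤ s → s < h → ∀ i, (m i * n) ⌈/⌉ (s + 1) ≤ m i * n / s :=
    fun s hs hsh => by
      rcases hs.eq_or_lt with rfl | hs
      · exact h₂
      · exact (hbelow s hs hsh).1
  have hchain : ∀ s, M + 1 ≤ s → s < h → ∀ k, ∑ i, (m i * n) ⌈/⌉ (s + 1) ≤ k →
      k ≤ ∑ i, m i * n / (M + 1) → (multipartiteTimesComplete m n).EquitablyColorable k := by
    intro s hs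
    induction s, hs using Nat.le_induction with
    | base =>
      intro hsh k hk₁ hk₂
      exact equitablyColorable_of_mem_interval (Nat.succ_pos M) h₂ hk₁ hk₂
    | succ s hs ih =>
      intro hsh k hk₁ hk₂
      rcases le_or_gt (∑ i, (m i * n) ⌈/⌉ (s + 1)) k with hk | hk
      · exact ih (by lia) k hk hk₂
      · obtain ⟨hb₁, hb₂⟩ := hbelow (s + 1) (by lia) hsh
        exact equitablyColorable_of_mem_interval (Nat.succ_pos s) hb₁ hk₁ (by lia)
  refine ⟨h, ⟨hh, hleast⟩, ?_⟩
  set T := ∑ i, (m i * n) ⌈/⌉ h with hT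
  have hTpos : 0 < T := by
    refine sum_pos (fun i _ => ?_) ⟨i₀, mem_univ _⟩
    exact (Nat.zero_le _).trans_lt (div_succ_lt_ceilDiv (hx i) (by lia))
  have hTle : T ≤ ∑ i, m i * n / (M + 1) := by
    refine sum_le_sum fun i _ => ?_
    have := hgood (h - 1) (by lia) (by lia) i
    rw [Nat.sub_add_cancel (by lia)] at this
    exact this.trans (Nat.div_le_div_left (by lia) (by lia))
  refine SimpleGraph.isEquitableChromaticThreshold_of_not (fun k hk => ?_) fun hcol => ?_
  · rcases le_or_gt (M * n) ((M + 1) * k) with hkM | hkM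
    · exact equitablyColorable_of_le_mul hMpos hMn hkM
    · refine hchain (h - 1) (by lia) (by lia) k ?_ (le_trans ?_ h₁)
      · rwa [Nat.sub_add_cancel (by lia)]
      · rw [Nat.le_div_iff_mul_le (by lia), mul_comm]
        exact hkM.le
  · have hlt : (M + 1) * (T - 1) < M * n :=
      (Nat.mul_lt_mul_of_pos_left (show T - 1 < ∑ i, m i * n / (M + 1) by lia)
        (Nat.succ_pos M)).trans_le (hsum (M + 1))
    obtain ⟨s, hs, hsgood, hlo, hup⟩ := exists_mem_interval_of_equitablyColorable hlt hcol
    rcases lt_or_ge s h with hsh | hsh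
    · have : T ≤ ∑ i, (m i * n) ⌈/⌉ (s + 1) :=
        sum_le_sum fun i _ => ceilDiv_le_ceilDiv_left (Nat.succ_pos s) hsh
      lia
    have hmono : ∀ t, 0 < t → t ≤ s → ∑ i, m i * n / s ≤ ∑ i, m i * n / t :=
      fun t ht hts => sum_le_sum fun i _ => Nat.div_le_div_left hts ht
    rcases hsh.eq_or_lt with rfl | hsh'
    · -- Either the interval of `h` is empty, or two of its quotients are rounded and it ends
      -- at or below `T - 2`.
      rcases hh.2 with ⟨i, hi⟩ | ⟨i, j, hij, hi, hj⟩
      · exact (hsgood i).not_gt hi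
      · have h2 : 1 < #{i | ¬ h ∣ m i * n} :=
          one_lt_card.2 ⟨i, by simpa using hi, j, by simpa using hj, hij⟩
        rw [sum_ceilDiv_eq (by lia)] at hT
        lia
    · -- Each quotient by `h + 1` is smaller than the rounded-up quotient by `h`, and `2 ≤ r`.
      have h3 : ∑ i, (m i * n / (h + 1) + 1) ≤ T :=
        sum_le_sum fun i _ => div_succ_lt_ceilDiv (hx i) (by lia)
      have := hmono (h + 1) (by lia) hsh'
      simp only [sum_add_distrib, sum_const, card_univ, Fintype.card_fin, smul_eq_mul,
        mul_one] at h3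
      lia

/-! ### Translation to natural number division -/

lemma natCeil_div_eq_ceilDiv (a : ℕ) {b : ℕ} (hb : 0 < b) : ⌈(a / b : ℚ)⌉₊ = a ⌈/⌉ b := by
  refine eq_of_forall_ge_iff fun c => ?_
  rw [Nat.ceil_le, ceilDiv_le_iff_le_mul hb, div_le_iff₀ (by exact_mod_cast hb), mul_comm]
  exact_mod_cast Iff.rfl

theorem theorem3p2 {r : ℕ} (hr : 2 ≤ r) (m : Fin r → ℕ) (hm : ∀ i, 1 ≤ m i)
    (n M : ℕ) (hM : M = ∑ i, m i) (hMn : M ≤ n) :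
    (((∑ i, ⌊(m i * n : ℚ) / (M + 1)⌋₊ < ⌊(M * n : ℚ) / (M + 1)⌋₊) ∨
        (∃ i, (m i * n : ℚ) / (M + 1) < (⌈(m i * n : ℚ) / (M + 2)⌉₊ : ℚ))) →
      (multipartiteTimesComplete m n).IsEquitableChromaticThreshold
        ⌈(M * n : ℚ) / (M + 1)⌉₊) ∧
    (¬ ((∑ i, ⌊(m i * n : ℚ) / (M + 1)⌋₊ < ⌊(M * n : ℚ) / (M + 1)⌋₊) ∨
        (∃ i, (m i * n : ℚ) / (M + 1) < (⌈(m i * n : ℚ) / (M + 2)⌉₊ : ℚ))) →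
      ∃ h : ℕ,
        IsLeast {t : ℕ | M + 2 ≤ t ∧
          ((∃ i, (m i * n : ℚ) / t < (⌈(m i * n : ℚ) / (t + 1)⌉₊ : ℚ)) ∨
            (∃ i j, i ≠ j ∧ ¬ t ∣ m i * n ∧ ¬ t ∣ m j * n))} h ∧
        (multipartiteTimesComplete m n).IsEquitableChromaticThreshold
          (∑ i, ⌈(m i * n : ℚ) / h⌉₊)) := by
  have hM2 : 2 ≤ M := by
    have : r ≤ ∑ i, m i := by simpa using sum_le_sum fun i (_ : i ∈ univ) => hm i
    lia
  have hfloor : ∀ a t : ℕ, ⌊(a * n : ℚ) / (t + 1)⌋₊ = a * n / (t + 1) := fun a t => by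
    exact_mod_cast Nat.floor_div_eq_div (K := ℚ) (a * n) (t + 1)
  have hceil : ∀ a t : ℕ, 0 < t → ⌈(a * n : ℚ) / t⌉₊ = (a * n) ⌈/⌉ t := fun a t ht => by
    exact_mod_cast natCeil_div_eq_ceilDiv (a * n) ht
  have hlt : ∀ a t c : ℕ, (a * n : ℚ) / t < c ↔ a * n / t < c := fun a t c => by
    rw [← Nat.floor_div_eq_div (K := ℚ) (a * n) t, Nat.floor_lt (by positivity), Nat.cast_mul]
  have hM1c : ((M : ℚ) + 1) = ((M + 1 : ℕ) : ℚ) := by push_cast; rfl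
  have hM2c : ((M : ℚ) + 2) = ((M + 2 : ℕ) : ℚ) := by push_cast; rfl
  have hset : {t : ℕ | M + 2 ≤ t ∧
          ((∃ i, (m i * n : ℚ) / t < (⌈(m i * n : ℚ) / (t + 1)⌉₊ : ℚ)) ∨
            (∃ i j, i ≠ j ∧ ¬ t ∣ m i * n ∧ ¬ t ∣ m j * n))} =
        {t : ℕ | M + 2 ≤ t ∧ ((∃ i, m i * n / t < (m i * n) ⌈/⌉ (t + 1)) ∨
          ∃ i j, i ≠ j ∧ ¬ t ∣ m i * n ∧ ¬ t ∣ m j * n)} := by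
    ext t
    simp only [Set.mem_ofPred_eq, hlt]
    simp only [← Nat.cast_add_one, hceil _ _ (Nat.succ_pos t)]
  rw [hset]
  simp only [hfloor]
  rw [hM1c, hM2c]
  simp only [hlt, hceil _ _ (Nat.succ_pos M), hceil _ _ (Nat.succ_pos (M + 1))]
  subst hM
  refine ⟨isEquitableChromaticThreshold_ceilDiv hM2 hMn, fun hnot => ?_⟩
  simp only [not_or, not_exists, not_lt] at hnot
  obtain ⟨h, hh, hT⟩ := exists_isLeast_and_isEquitableChromaticThreshold hr hm (by lia) hMn
    hnot.1 hnot.2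
  refine ⟨h, hh, ?_⟩
  have hpos : 0 < h := by have := hh.1.1; lia
  simpa only [hceil _ _ hpos] using hT
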